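/- Let $\mathbb U$ be the open unit disc and $H^2$ the Hardy space of all holomorphic $f$ on $\mathbb U$ with $\|f\|^2=\sup_{0\le r<1}\frac1{2\pi}\int_0^{2\pi}|f(re^{i\theta})|^2\,d\theta<\infty$. Let $\mu>1$ and let $\varphi$ be the canonical hyperbolic automorphism of $\mathbb U$ with multiplier $\mu$, i.e. the automorphism determined by $\frac{1+\varphi(z)}{1-\varphi(z)}=\mu\,\frac{1+z}{1-z}$ for $z\in\mathbb U$; equivalently $\varphi(z)=\frac{r+z}{1+rz}$ with $r=\frac{\mu-1}{\mu+1}$. (It fixes $+1$, attractive, and $-1$, repulsive.) Let $C_\varphi g=g\circ\varphi$ be the induced bounded composition operator on $H^2$, let $\varphi_n$ ($n\in\mathbb Z$) be the $n$-th compositional iterate of $\varphi$ (with $\varphi_0=\mathrm{id}$ and $\varphi_{-n}=(\varphi^{-1})_n$), and for $f\in H^2$ let $D_f$ be the closure in $H^2$ of the linear span of $\{f\circ\varphi_n:n\in\mathbb Z\}$, which is invariant under $C_\varphi$. Theorem 3.2. Let $f\in\sqrt{(z+1)(z-1)}\,H^2$ with $f\neq0$; that is, $f=s\,g$ where $g\in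 H^2$ and $s$ is a holomorphic function on $\mathbb U$ with $s(z)^2=(z+1)(z-1)$. Then the point spectrum (set of eigenvalues) $\sigma_p(C_\varphi|_{D_f})$ of the restriction of $C_\varphi$ to $D_f$ intersects the unit circle $\partial\mathbb U$ in a set of positive arc-length measure; more precisely, $\sigma_p(C_\varphi|_{D_f})\cap\partial\mathbb U$ contains a Borel set of positive arc-length measure. -/

import Mathlib

noncomputable section

namespace HardyDisc

open Complex Metric Set Real

/-! ### Functions on the open unit disc -/

/-- The extension by `0` of a function on the open unit disc to the whole plane. -/
def extend (f : UnitDisc → ℂ) (z : ℂ) : ℂ :=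
  if h : ‖z‖ < 1 then f (UnitDisc.mk z h) else 0

lemma extend_coe (f : UnitDisc → ℂ) (z : UnitDisc) : extend f z = f z := by
  simp [extend, z.norm_lt_one]

lemma extend_add (f g : UnitDisc → ℂ) : extend (f + g) = extend f + extend g := by
  funext z
  by_cases h : ‖z‖ < 1 <;> simp [extend, h]

lemma extend_smul (c : ℂ) (f : UnitDisc → ℂ) : extend (c • f) = c • extend f := by
  funext z
  by_cases h : ‖z‖ < 1 <;> simp [extend, h]

/-- `f` is holomorphic on the open unit disc. -/
def IsHolo (f : UnitDisc → ℂ) : Prop := DifferentiableOn ℂ (extend f) (ball 0 1)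

/-- The integral mean `(1 / 2π) ∫₀^{2π} |f(r e^{iθ})|² dθ`, for `0 ≤ r < 1`. -/
def sqMean (f : UnitDisc → ℂ) (r : ℝ) : ℝ := circleAverage (fun z ↦ ‖extend f z‖ ^ 2) 0 r

lemma sqMean_nonneg (f : UnitDisc → ℂ) (r : ℝ) : 0 ≤ sqMean f r :=
  circleAverage_nonneg_of_nonneg fun _ _ ↦ by positivity

lemma IsHolo.circleIntegrable {f : UnitDisc → ℂ} (hf : IsHolo f) {r : ℝ} (hr : r ∈ Ico (0 : ℝ) 1) :
    CircleIntegrable (fun z ↦ ‖extend f z‖ ^ 2) 0 r := by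
  refine ContinuousOn.circleIntegrable hr.1 ?_
  have h : sphere (0 : ℂ) r ⊆ ball 0 1 := sphere_subset_ball hr.2
  exact ((hf.continuousOn.mono h).norm).pow 2

lemma sqMean_add_le {f g : UnitDisc → ℂ} (hf : IsHolo f) (hg : IsHolo g) {r : ℝ}
    (hr : r ∈ Ico (0 : ℝ) 1) {t : ℝ} (ht : 0 < t) :
    sqMean (f + g) r ≤ (1 + t) * sqMean f r + (1 + t⁻¹) * sqMean g r := by
  have hfg : IsHolo (f + g) := by
    unfold IsHolo
    rw [extend_add]
    exact DifferentiableOn.add hf hg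
  have h1 := hf.circleIntegrable hr
  have h2 := hg.circleIntegrable hr
  have h1' : CircleIntegrable (fun z ↦ (1 + t) • ‖extend f z‖ ^ 2) 0 r := h1.const_smul
  have h2' : CircleIntegrable (fun z ↦ (1 + t⁻¹) • ‖extend g z‖ ^ 2) 0 r := h2.const_smul
  have e : (1 + t) * sqMean f r + (1 + t⁻¹) * sqMean g r =
      circleAverage (fun z ↦ (1 + t) • ‖extend f z‖ ^ 2 + (1 + t⁻¹) • ‖extend g z‖ ^ 2) 0 r := by
    rw [circleAverage_fun_add h1' h2', circleAverage_fun_smul, circleAverage_fun_smul]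
    rfl
  rw [e]
  refine circleAverage_mono (hfg.circleIntegrable hr) (h1'.add h2') fun z _ ↦ ?_
  rw [extend_add]
  simp only [Pi.add_apply, smul_eq_mul]
  set a := ‖extend f z‖
  set b := ‖extend g z‖
  have hab : ‖extend f z + extend g z‖ ≤ a + b := norm_add_le _ _
  have h0 : 0 ≤ ‖extend f z + extend g z‖ := norm_nonneg _
  have h3 : (a + b) ^ 2 ≤ (1 + t) * a ^ 2 + (1 + t⁻¹) * b ^ 2 := by
    have : (1 + t) * a ^ 2 + (1 + t⁻¹) * b ^ 2 - (a + b) ^ 2 = t⁻¹ * (t * a - b) ^ 2 := by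
      field_simp
      ring
    have h4 : 0 ≤ t⁻¹ * (t * a - b) ^ 2 := by positivity
    linarith
  nlinarith

lemma sqMean_smul (c : ℂ) (f : UnitDisc → ℂ) (r : ℝ) :
    sqMean (c • f) r = ‖c‖ ^ 2 * sqMean f r := by
  have : (fun z ↦ ‖extend (c • f) z‖ ^ 2) = fun z ↦ (‖c‖ ^ 2) • ‖extend f z‖ ^ 2 := by
    funext z
    rw [extend_smul]
    simp [mul_pow]
  unfold sqMean
  rw [this, circleAverage_fun_smul]
  rfl

/-! ### The Hardy space `H²` -/

/-- The holomorphic functions on the unit disc with bounded integral means of order two. -/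
def hardySubmodule : Submodule ℂ (UnitDisc → ℂ) where
  carrier := {f | IsHolo f ∧ BddAbove (range fun r : Ico (0 : ℝ) 1 ↦ sqMean f r)}
  add_mem' := by
    rintro f g ⟨hf, A, hA⟩ ⟨hg, B, hB⟩
    refine ⟨?_, (1 + 1) * A + (1 + 1) * B, ?_⟩
    · unfold IsHolo
      rw [extend_add]
      exact DifferentiableOn.add hf hg
    · rintro _ ⟨r, rfl⟩
      have h := sqMean_add_le hf hg r.2 one_pos
      have h1 := hA ⟨r, rfl⟩
      have h2 := hB ⟨r, rfl⟩
      simp only [inv_one] at h h1 h2 ⊢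
      linarith
  zero_mem' := by
    have h : extend 0 = fun _ ↦ 0 := by
      funext z
      simp [extend]
    refine ⟨?_, 0, ?_⟩
    · unfold IsHolo
      rw [h]
      exact differentiableOn_const 0
    · rintro _ ⟨r, rfl⟩
      simp [sqMean, h, circleAverage_const]
  smul_mem' := by
    rintro c f ⟨hf, A, hA⟩
    refine ⟨?_, ‖c‖ ^ 2 * A, ?_⟩
    · unfold IsHolo
      rw [extend_smul]
      exact DifferentiableOn.const_smul hf c
    · rintro _ ⟨r, rfl⟩
      simp only [sqMean_smul]
      exact mul_le_mul_of_nonneg_left (hA ⟨r, rfl⟩) (by positivity)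

/-- The Hardy space `H²` of the unit disc. -/
def H2 : Type := hardySubmodule

namespace H2

instance : AddCommGroup H2 := inferInstanceAs (AddCommGroup hardySubmodule)

instance : Module ℂ H2 := inferInstanceAs (Module ℂ hardySubmodule)

instance : CoeFun H2 (fun _ ↦ UnitDisc → ℂ) := ⟨fun f ↦ f.1⟩

/-- `‖f‖² = sup_{0 ≤ r < 1} (1 / 2π) ∫₀^{2π} |f(r e^{iθ})|² dθ`. -/
instance : Norm H2 := ⟨fun f ↦ √(⨆ r : Ico (0 : ℝ) 1, sqMean f r)⟩

instance : Nonempty (Ico (0 : ℝ) 1) := ⟨⟨0, by simp⟩⟩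

@[ext] lemma ext {f g : H2} (h : ∀ z, f z = g z) : f = g := Subtype.ext (funext h)

@[simp] lemma add_apply (f g : H2) (z : UnitDisc) : (f + g) z = f z + g z := rfl

@[simp] lemma smul_apply (c : ℂ) (f : H2) (z : UnitDisc) : (c • f) z = c * f z := rfl

@[simp] lemma zero_apply (z : UnitDisc) : (0 : H2) z = 0 := rfl

lemma isHolo (f : H2) : IsHolo f := f.2.1

lemma norm_sq (f : H2) : ‖f‖ ^ 2 = ⨆ r : Ico (0 : ℝ) 1, sqMean f r :=
  Real.sq_sqrt (Real.iSup_nonneg fun _ ↦ sqMean_nonneg _ _)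

lemma norm_nonneg' (f : H2) : 0 ≤ ‖f‖ := Real.sqrt_nonneg _

lemma sqMean_le (f : H2) {r : ℝ} (hr : r ∈ Ico (0 : ℝ) 1) : sqMean f r ≤ ‖f‖ ^ 2 := by
  rw [norm_sq]
  exact le_ciSup (f := fun r : Ico (0 : ℝ) 1 ↦ sqMean f r) f.2.2 ⟨r, hr⟩

lemma norm_sq_le (f : H2) {A : ℝ} (h : ∀ r ∈ Ico (0 : ℝ) 1, sqMean f r ≤ A) : ‖f‖ ^ 2 ≤ A := by
  rw [norm_sq]
  exact ciSup_le fun r ↦ h r r.2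

/-- The Poisson integral over a circle of radius `ρ < 1` dominates `|f|²` inside that circle. -/
lemma sq_le_poisson (f : H2) {ρ : ℝ} (hρ : ρ < 1) {w : ℂ} (hw : w ∈ ball (0 : ℂ) ρ) :
    ‖extend f w‖ ^ 2 ≤
      circleAverage (fun z ↦ (herglotzRieszKernel 0 w z).re * ‖extend f z‖ ^ 2) 0 ρ := by
  have hρ0 : 0 < ρ := pos_of_mem_ball hw
  have hc : DiffContOnCl ℂ (fun z ↦ extend f z ^ 2) (ball (0 : ℂ) ρ) := by
    refine DifferentiableOn.diffContOnCl ?_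
    rw [closure_ball _ hρ0.ne']
    exact (f.isHolo.mono (closedBall_subset_ball hρ)).pow 2
  have h := hc.circleAverage_re_herglotzRieszKernel_smul hw
  rw [← norm_pow, ← h]
  simp only [circleAverage_def, norm_smul]
  rw [smul_eq_mul, Real.norm_of_nonneg (by positivity)]
  refine mul_le_mul_of_nonneg_left ?_ (by positivity)
  refine (intervalIntegral.norm_integral_le_integral_norm (by positivity)).trans (le_of_eq ?_)
  refine intervalIntegral.integral_congr fun θ _ ↦ ?_
  have hs : circleMap 0 ρ θ ∈ sphere (0 : ℂ) ρ := circleMap_mem_sphere 0 hρ0.le θ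
  have hle := le_re_herglotzRieszKernel hs hw
  have hw' : ‖w‖ < ρ := by simpa using hw
  have hpos : 0 ≤ (herglotzRieszKernel 0 w (circleMap 0 ρ θ)).re := by
    refine le_trans ?_ hle
    rw [sub_zero]
    exact div_nonneg (by linarith) (by linarith [norm_nonneg w])
  simp [abs_of_nonneg hpos]

lemma re_kernel_mul_le (f : H2) {ρ : ℝ} (hρ : ρ < 1) {w : ℂ} (hw : w ∈ ball (0 : ℂ) ρ) :
    circleAverage (fun z ↦ (herglotzRieszKernel 0 w z).re * ‖extend f z‖ ^ 2) 0 ρ ≤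
      (ρ + ‖w‖) / (ρ - ‖w‖) * ‖f‖ ^ 2 := by
  have hρ0 : 0 < ρ := pos_of_mem_ball hw
  have hw' : ‖w‖ < ρ := by simpa using hw
  have hi := f.isHolo.circleIntegrable ⟨hρ0.le, hρ⟩
  have hk : ContinuousOn (fun z ↦ (herglotzRieszKernel 0 w z).re) (sphere 0 |ρ|) :=
    Complex.continuous_re.comp_continuousOn (continuousOn_herglotzRieszKernel_sphere hw)
  have h1 : CircleIntegrable (fun z ↦ (herglotzRieszKernel 0 w z).re * ‖extend f z‖ ^ 2) 0 ρ :=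
    hi.continuousOn_smul hk
  have hC : 0 ≤ (ρ + ‖w‖) / (ρ - ‖w‖) := div_nonneg (by positivity) (by linarith)
  calc circleAverage (fun z ↦ (herglotzRieszKernel 0 w z).re * ‖extend f z‖ ^ 2) 0 ρ
      ≤ circleAverage (fun z ↦ ((ρ + ‖w‖) / (ρ - ‖w‖)) • ‖extend f z‖ ^ 2) 0 ρ := by
        refine circleAverage_mono h1 hi.const_smul fun z hz ↦ ?_
        rw [abs_of_pos hρ0] at hz
        have := re_herglotzRieszKernel_le hz hw
        rw [← herglotzRieszKernel_def, sub_zero] at this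
        exact mul_le_mul_of_nonneg_right this (by positivity)
    _ = (ρ + ‖w‖) / (ρ - ‖w‖) * sqMean f ρ := by
        rw [circleAverage_fun_smul]
        rfl
    _ ≤ _ := mul_le_mul_of_nonneg_left (f.sqMean_le ⟨hρ0.le, hρ⟩) hC

lemma core : NormedSpace.Core ℂ H2 where
  norm_nonneg := norm_nonneg'
  norm_smul c f := by
    have h : ‖c • f‖ ^ 2 = (‖c‖ * ‖f‖) ^ 2 := by
      rw [norm_sq, mul_pow, norm_sq, Real.mul_iSup_of_nonneg (by positivity)]
      exact iSup_congr fun r ↦ sqMean_smul c f r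
    exact (sq_eq_sq₀ (norm_nonneg' _) (mul_nonneg (norm_nonneg c) (norm_nonneg' f))).1 h
  norm_triangle f g := by
    have key : ∀ t : ℝ, 0 < t → ‖f + g‖ ^ 2 ≤ (1 + t) * ‖f‖ ^ 2 + (1 + t⁻¹) * ‖g‖ ^ 2 := by
      intro t ht
      refine norm_sq_le _ fun r hr ↦ (sqMean_add_le f.isHolo g.isHolo hr ht).trans ?_
      have := f.sqMean_le hr
      have := g.sqMean_le hr
      gcongr
    have ha := norm_nonneg' f
    have hb := norm_nonneg' g
    set a := ‖f‖
    set b := ‖g‖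
    refine le_of_forall_pos_le_add fun ε hε ↦ ?_
    refine abs_le_of_sq_le_sq' ?_ (by positivity) |>.2
    have h := key ((b + ε / 2) / (a + ε / 2)) (by positivity)
    refine h.trans ?_
    have ha' : a ≤ a + ε / 2 := by linarith
    have hb' : b ≤ b + ε / 2 := by linarith
    calc _ ≤ (1 + (b + ε / 2) / (a + ε / 2)) * (a + ε / 2) ^ 2
          + (1 + ((b + ε / 2) / (a + ε / 2))⁻¹) * (b + ε / 2) ^ 2 := by gcongr
      _ = (a + b + ε) ^ 2 := by
          field_simp
          ring
  norm_eq_zero_iff f := by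
    constructor
    · intro h
      ext z
      obtain ⟨ρ, h1, h2⟩ := exists_between z.norm_lt_one
      have hz : (z : ℂ) ∈ ball (0 : ℂ) ρ := by simpa using h1
      have := (f.sq_le_poisson h2 hz).trans (f.re_kernel_mul_le h2 hz)
      rw [h, extend_coe] at this
      have h0 : ‖f z‖ ^ 2 = 0 := le_antisymm (by simpa using this) (by positivity)
      simpa using h0
    · rintro rfl
      have h0 : ‖(0 : H2)‖ ^ 2 ≤ 0 := by
        refine norm_sq_le _ fun r _ ↦ ?_
        have := sqMean_smul 0 (0 : UnitDisc → ℂ) r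
        rw [smul_zero] at this
        exact le_of_eq (this.trans (by simp))
      exact pow_eq_zero_iff (two_ne_zero) |>.1 (le_antisymm h0 (by positivity))

instance : NormedAddCommGroup H2 := NormedAddCommGroup.ofCore core

instance : NormedSpace ℂ H2 := NormedSpace.ofCore core

end H2

/-! ### Automorphisms of the disc and composition operators -/

/-- `φ` is a holomorphic map of the open unit disc into itself. -/
def IsHoloMap (φ : UnitDisc → UnitDisc) : Prop := IsHolo fun z ↦ (φ z : ℂ)

lemma IsHoloMap.eqOn_comp (φ : UnitDisc → UnitDisc) (f : UnitDisc → ℂ) :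
    EqOn (extend (f ∘ φ)) (extend f ∘ extend fun z ↦ (φ z : ℂ)) (ball 0 1) := by
  intro z hz
  lift z to UnitDisc using by simpa using hz
  simp [extend_coe]

lemma extend_mem_ball (φ : UnitDisc → UnitDisc) {z : ℂ} (hz : z ∈ ball (0 : ℂ) 1) :
    extend (fun z ↦ (φ z : ℂ)) z ∈ ball (0 : ℂ) 1 := by
  lift z to UnitDisc using by simpa using hz
  simpa [extend_coe] using (φ z).norm_lt_one

lemma IsHolo.comp {f : UnitDisc → ℂ} (hf : IsHolo f) {φ : UnitDisc → UnitDisc}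
    (hφ : IsHoloMap φ) : IsHolo (f ∘ φ) :=
  (DifferentiableOn.comp hf hφ fun _ hz ↦ extend_mem_ball φ hz).congr (IsHoloMap.eqOn_comp φ f)

/-- The group of holomorphic automorphisms of the open unit disc, under composition. -/
def DiscAut : Subgroup (Equiv.Perm UnitDisc) where
  carrier := {φ | IsHoloMap φ ∧ IsHoloMap φ.symm}
  mul_mem' {φ ψ} hφ hψ := ⟨IsHolo.comp hφ.1 hψ.1, IsHolo.comp hψ.2 hφ.2⟩
  one_mem' := by
    have h : IsHoloMap id := differentiableOn_id.congr fun z hz ↦ by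
      lift z to UnitDisc using by simpa using hz
      simp [extend_coe]
    exact ⟨h, h⟩
  inv_mem' {_} hφ := ⟨hφ.2, hφ.1⟩

instance : CoeFun DiscAut (fun _ ↦ UnitDisc → UnitDisc) := ⟨fun φ ↦ φ.1⟩

/-- Composition with a holomorphic self-map of the disc is bounded on `H²`. -/
lemma sqMean_comp_le (f : H2) {φ : UnitDisc → UnitDisc} (hφ : IsHoloMap φ) {s : ℝ}
    (hs : s ∈ Ico (0 : ℝ) 1) :
    sqMean (f ∘ φ) s ≤ 4 / (1 - ‖(φ 0 : ℂ)‖) * ‖f‖ ^ 2 := by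
  set Φ : ℂ → ℂ := extend fun z ↦ (φ z : ℂ) with hΦ
  have hsub : closedBall (0 : ℂ) s ⊆ ball 0 1 := closedBall_subset_ball hs.2
  have hΦc : ContinuousOn Φ (closedBall 0 s) := hφ.continuousOn.mono hsub
  have h0 : (0 : ℂ) ∈ ball (0 : ℂ) 1 := by simp
  have hΦ0 : Φ 0 = φ 0 := by simpa using extend_coe (fun z ↦ (φ z : ℂ)) 0
  set b : ℝ := ‖(φ 0 : ℂ)‖ with hb
  have hb1 : b < 1 := (φ 0).norm_lt_one
  have hb0 : 0 ≤ b := norm_nonneg _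
  obtain ⟨z₀, hz₀, hmax⟩ := (isCompact_closedBall (0 : ℂ) s).exists_isMaxOn
    ⟨0, by simpa using hs.1⟩ hΦc.norm
  have hz₁ : ‖Φ z₀‖ < 1 := by simpa using extend_mem_ball φ (hsub hz₀)
  obtain ⟨ρ, hρ, hρ1⟩ : ∃ ρ, max ‖Φ z₀‖ ((1 + b) / 2) < ρ ∧ ρ < 1 :=
    exists_between (max_lt hz₁ (by linarith))
  have hρz : ‖Φ z₀‖ < ρ := (le_max_left _ _).trans_lt hρ
  have hρb : (1 + b) / 2 < ρ := (le_max_right _ _).trans_lt hρ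
  have hρ0 : 0 < ρ := by linarith
  have hmaps : ∀ z ∈ closedBall (0 : ℂ) s, Φ z ∈ ball (0 : ℂ) ρ := fun z hz ↦ by
    simpa using (hmax hz).trans_lt hρz
  have hi := f.isHolo.circleIntegrable ⟨hρ0.le, hρ1⟩
  set K : ℂ → ℂ := fun w ↦ circleAverage
    (fun z ↦ herglotzRieszKernel 0 w z • ((‖extend f z‖ ^ 2 : ℝ) : ℂ)) 0 ρ with hK
  have hKre : ∀ w ∈ ball (0 : ℂ) ρ, (K w).re =
      circleAverage (fun z ↦ (herglotzRieszKernel 0 w z).re * ‖extend f z‖ ^ 2) 0 ρ :=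
    fun w hw ↦ re_circleAverage_herglotzRieszKernel_smul hi hw
  have hKd : DifferentiableOn ℂ K (ball 0 ρ) := by
    refine differentiableOn_circleAverage_herglotzRieszKernel_smul ?_
    have h1 : IntervalIntegrable (fun θ ↦ ‖extend f (circleMap 0 ρ θ)‖ ^ 2)
      MeasureTheory.volume 0 (2 * π) := hi
    rw [intervalIntegrable_iff] at h1
    exact intervalIntegrable_iff.2 (Complex.ofRealCLM.integrable_comp h1)
  have hKΦ : DifferentiableOn ℂ (K ∘ Φ) (closedBall 0 s) :=
    hKd.comp (hφ.mono hsub) hmaps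
  have hcont : ContinuousOn (K ∘ Φ) (sphere 0 |s|) := by
    rw [abs_of_nonneg hs.1]
    exact hKΦ.continuousOn.mono sphere_subset_closedBall
  have hmean : circleAverage (K ∘ Φ) 0 s = K (Φ 0) := by
    refine DiffContOnCl.circleAverage ?_
    rw [abs_of_nonneg hs.1]
    refine ⟨hKΦ.mono ball_subset_closedBall, ?_⟩
    exact hKΦ.continuousOn.mono closure_ball_subset_closedBall
  have hmean' : circleAverage (fun z ↦ (K (Φ z)).re) 0 s = (K (Φ 0)).re := by
    rw [← hmean]
    exact ContinuousLinearMap.circleAverage_comp_comm Complex.reCLM hcont.circleIntegrable'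
  have hre : CircleIntegrable (fun z ↦ (K (Φ z)).re) 0 s :=
    (Complex.continuous_re.comp_continuousOn hcont).circleIntegrable'
  have hstep : sqMean (f ∘ φ) s ≤ circleAverage (fun z ↦ (K (Φ z)).re) 0 s := by
    refine circleAverage_mono ((f.isHolo.comp hφ).circleIntegrable hs) hre fun z hz ↦ ?_
    rw [abs_of_nonneg hs.1] at hz
    have hz' := sphere_subset_closedBall hz
    rw [IsHoloMap.eqOn_comp φ f (hsub hz'), hKre _ (hmaps z hz')]
    exact f.sq_le_poisson hρ1 (hmaps z hz')
  have h00 : (0 : ℂ) ∈ closedBall (0 : ℂ) s := by simpa using hs.1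
  rw [hmean', hKre _ (hmaps 0 h00)] at hstep
  refine hstep.trans ((f.re_kernel_mul_le hρ1 (hmaps 0 h00)).trans ?_)
  rw [hΦ0, ← hb]
  refine mul_le_mul_of_nonneg_right ?_ (by positivity)
  rw [div_le_div_iff₀ (by linarith) (by linarith)]
  nlinarith

/-- The composition operator `C_φ f = f ∘ φ` on `H²`. -/
def compOp (φ : DiscAut) : H2 →L[ℂ] H2 :=
  LinearMap.mkContinuous
    { toFun := fun f ↦ ⟨f ∘ φ, f.isHolo.comp φ.2.1, 4 / (1 - ‖(φ 0 : ℂ)‖) * ‖f‖ ^ 2, by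
        rintro _ ⟨s, rfl⟩
        exact sqMean_comp_le f φ.2.1 s.2⟩
      map_add' := fun _ _ ↦ rfl
      map_smul' := fun _ _ ↦ rfl }
    √(4 / (1 - ‖(φ 0 : ℂ)‖)) fun f ↦ by
      have hC : 0 ≤ 4 / (1 - ‖(φ 0 : ℂ)‖) :=
        div_nonneg (by norm_num) (by linarith [(φ 0).norm_lt_one])
      refine abs_le_of_sq_le_sq' ?_ (by positivity) |>.2
      rw [mul_pow, Real.sq_sqrt hC]
      exact H2.norm_sq_le _ fun s hs ↦ sqMean_comp_le f φ.2.1 hs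

@[simp] lemma compOp_apply (φ : DiscAut) (f : H2) (z : UnitDisc) : compOp φ f z = f (φ z) := rfl

/-- The doubly cyclic subspace `D_f`: the closure in `H²` of the linear span of the functions
`f ∘ φ_n`, `n ∈ ℤ`, where `φ_n` is the `n`-th compositional iterate of `φ` (of `φ⁻¹`, `|n|` times,
when `n < 0`). -/
def doublyCyclic (φ : DiscAut) (f : H2) : Submodule ℂ H2 :=
  (Submodule.span ℂ (range fun n : ℤ ↦ compOp (φ ^ n) f)).topologicalClosure

lemma compOp_mem_doublyCyclic (φ : DiscAut) (f : H2) :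
    ∀ g ∈ doublyCyclic φ f, compOp φ g ∈ doublyCyclic φ f := by
  have h : Submodule.span ℂ (range fun n : ℤ ↦ compOp (φ ^ n) f) ≤
      (Submodule.span ℂ (range fun n : ℤ ↦ compOp (φ ^ n) f)).comap (compOp φ).toLinearMap := by
    rw [Submodule.span_le]
    rintro _ ⟨n, rfl⟩
    refine Submodule.subset_span ⟨n + 1, ?_⟩
    ext z
    simp [zpow_add]
  intro g hg
  exact map_mem_closure (compOp φ).continuous hg fun x hx ↦ h hx

/-- The restriction `C_φ|_{D_f}` of the composition operator to the doubly cyclic subspace. -/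
def compOpRestrict (φ : DiscAut) (f : H2) : Module.End ℂ (doublyCyclic φ f) :=
  (compOp φ).toLinearMap.restrict (compOp_mem_doublyCyclic φ f)

/-- The point spectrum (set of eigenvalues) of a linear operator. -/
def pointSpectrum {V : Type*} [AddCommGroup V] [Module ℂ V] (T : Module.End ℂ V) : Set ℂ :=
  {c | T.HasEigenvalue c}

/-- The inverse Cayley transform `z ↦ (1 + z) / (1 - z)` from the unit disc onto the right
half-plane; it sends `-1` to `0` and `1` to `∞`. -/
def cayleyInv (z : UnitDisc) : ℂ := (1 + z) / (1 - z)

/-- `φ` is the canonical hyperbolic automorphism of the disc with multiplier `μ > 1`: it fixes `-1`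
(repulsive) and `1` (attractive), and the Cayley transform conjugates it to the dilation
`w ↦ μ w`. -/
def IsCanonicalHyperbolic (μ : ℝ) (φ : DiscAut) : Prop :=
  1 < μ ∧ ∀ z : UnitDisc, cayleyInv (φ z) = μ * cayleyInv z

/-- The set `√((z + 1)(z - 1)) H²`; the square root is any holomorphic branch on the disc (the two
branches differ by a sign and give the same set). -/
def sqrtH2 : Set H2 :=
  {f | ∃ s : UnitDisc → ℂ, IsHolo s ∧ (∀ z : UnitDisc, s z ^ 2 = ((z : ℂ) + 1) * ((z : ℂ) - 1)) ∧
    ∃ g : H2, ∀ z : UnitDisc, f z = s z * g z}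

/-- Normalized arc length measure on the unit circle, as a measure on `ℂ`. -/
def arcMeasure : MeasureTheory.Measure ℂ :=
  ENNReal.ofReal (2 * π)⁻¹ •
    (MeasureTheory.volume.restrict (Ioc 0 (2 * π))).map (circleMap 0 1)

end HardyDisc

end

section

open scoped InnerProductSpace ComplexConjugate
open MeasureTheory Filter Topology Metric
open Complex (UnitDisc)

noncomputable section

namespace HardyDisc

/-! ### Fourier series with coefficients in a Hilbert space -/

/-! Put `v n = f ∘ φ_n`, so that `C_φ` maps `v n` to `v (n + 1)`. If `∑ ‖v n‖²` is finite, the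
Fourier series `F(z) = ∑ z⁻ⁿ v n` converges in `L²` of the circle with values in `H²`, and
reindexing gives `C_φ F(z) = z F(z)`. Its zeroth coefficient is `f ≠ 0`, so `F` is nonzero on a set
of positive measure, and there `F(z)` is an eigenvector. It lies in `D_f` as a limit of partial
sums. This is `exists_eigenvector_of_shift`; the Hilbert space structure it needs comes from
Parseval's identity, which identifies `H²` with `ℓ²`.

What remains is `summable_norm_sq_compOp_zpow`. By subordination `‖f ∘ φ_n‖²` is at most the
integral of `|f|² = |z² - 1| |g|²` against the Poisson kernel at `φ_n(0) = (μⁿ - 1)/(μⁿ + 1)`. On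
the circle, with `p = √(1 - Re z)` and `q = √(1 + Re z)`, this kernel times `|z² - 1|` equals
`4Xq/(X² + q²)`, where `X = μⁿ p`. As `n` varies `X` runs through a geometric progression, and the
terms decay geometrically away from `X ≈ q`; their sum is at most `8μ/(μ - 1)`, whatever `z` is.
Hence `∑ ‖f ∘ φ_n‖² ≤ 8μ/(μ - 1) ‖g‖²`. Boundary values are avoided by replacing `g(z)` with `g(ρz)`
and letting `ρ → 1`. -/

instance : IsProbabilityMeasure arcMeasure := by
  constructor
  rw [arcMeasure, Measure.smul_apply, Measure.map_apply (continuous_circleMap 0 1).measurable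
    MeasurableSet.univ, Set.preimage_univ, Measure.restrict_apply_univ, Real.volume_Ioc, sub_zero,
    smul_eq_mul, ← ENNReal.ofReal_mul (by positivity), inv_mul_cancel₀ (by positivity),
    ENNReal.ofReal_one]

lemma ae_arcMeasure_norm_eq_one : ∀ᵐ z ∂arcMeasure, ‖z‖ = 1 := by
  refine Measure.ae_smul_measure ?_ _
  rw [ae_map_iff (continuous_circleMap 0 1).aemeasurable
    (measurableSet_eq_fun measurable_norm measurable_const)]
  exact Eventually.of_forall fun θ ↦ by simp

lemma integral_arcMeasure {E : Type*} [NormedAddCommGroup E] [NormedSpace ℝ E] {f : ℂ → E}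
    (hf : StronglyMeasurable f) :
    ∫ z, f z ∂arcMeasure = Real.circleAverage f 0 1 := by
  rw [arcMeasure, integral_smul_measure, integral_map (continuous_circleMap 0 1).aemeasurable
    hf.aestronglyMeasurable, Real.circleAverage, intervalIntegral.integral_of_le (by positivity),
    ENNReal.toReal_ofReal (by positivity)]

lemma circleAverage_zpow {k : ℤ} (hk : k ≠ 0) {r : ℝ} (hr : 0 < r) :
    Real.circleAverage (fun z : ℂ ↦ z ^ k) 0 r = 0 := by
  have h : Set.EqOn (fun z : ℂ ↦ (z - 0)⁻¹ • z ^ k) (fun z ↦ (z - 0) ^ (k - 1))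
      (Metric.sphere (0 : ℂ) r) := by
    intro z hz
    have hz0 : z ≠ 0 := by
      rintro rfl
      simp [hr.ne] at hz
    simp only [sub_zero, smul_eq_mul]
    rw [zpow_sub_one₀ hz0, mul_comm]
  rw [Real.circleAverage_eq_circleIntegral hr.ne', circleIntegral.integral_congr hr.le h,
    circleIntegral.integral_sub_zpow_of_ne (by omega), smul_zero]

lemma integral_arcMeasure_zpow {k : ℤ} (hk : k ≠ 0) : ∫ z : ℂ, z ^ k ∂arcMeasure = 0 := by
  rw [integral_arcMeasure (by fun_prop), circleAverage_zpow hk one_pos]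

section Fourier

variable {H : Type*} [NormedAddCommGroup H] [InnerProductSpace ℂ H]

lemma stronglyMeasurable_zpow_smul (n : ℤ) (x : H) :
    StronglyMeasurable fun z : ℂ ↦ z ^ n • x :=
  (show StronglyMeasurable fun z : ℂ ↦ z ^ n by fun_prop).smul_const x

lemma eLpNorm_zpow_smul (n : ℤ) (x : H) :
    eLpNorm (fun z : ℂ ↦ z ^ n • x) 2 arcMeasure = ‖x‖ₑ := by
  rw [eLpNorm_congr_norm_ae (g := fun _ ↦ x), eLpNorm_const' x two_ne_zero ENNReal.ofNat_ne_top]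
  · simp
  · filter_upwards [ae_arcMeasure_norm_eq_one] with z hz
    simp [norm_smul, hz]

lemma memLp_zpow_smul (n : ℤ) (x : H) : MemLp (fun z : ℂ ↦ z ^ n • x) 2 arcMeasure :=
  ⟨(stronglyMeasurable_zpow_smul n x).aestronglyMeasurable, by
    rw [eLpNorm_zpow_smul]; exact enorm_lt_top⟩

/-- The isometric embedding `x ↦ (z ↦ z ^ n • x)` of `H` into `L²` of the circle. -/
def zpowLp (n : ℤ) : H →ₗᵢ[ℂ] Lp H 2 arcMeasure where
  toFun x := (memLp_zpow_smul n x).toLp _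
  map_add' x y := by
    rw [← MemLp.toLp_add]
    congr 1
    funext z
    simp
  map_smul' c x := by
    rw [RingHom.id_apply, ← MemLp.toLp_const_smul]
    congr 1
    funext z
    simp [smul_comm c]
  norm_map' x := by
    simp [Lp.norm_toLp, eLpNorm_zpow_smul]

lemma coeFn_zpowLp (n : ℤ) (x : H) : zpowLp n x =ᵐ[arcMeasure] fun z ↦ z ^ n • x :=
  MemLp.coeFn_toLp (memLp_zpow_smul n x)

lemma orthogonalFamily_zpowLp :
    OrthogonalFamily ℂ (fun _ : ℤ ↦ H) fun n ↦ (zpowLp n : H →ₗᵢ[ℂ] Lp H 2 arcMeasure) := by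
  intro m n hmn x y
  rw [L2.inner_def]
  have h : (fun z ↦ ⟪zpowLp m x z, zpowLp n y z⟫_ℂ) =ᵐ[arcMeasure]
      fun z ↦ z ^ (n - m) * ⟪x, y⟫_ℂ := by
    filter_upwards [coeFn_zpowLp m x, coeFn_zpowLp n y, ae_arcMeasure_norm_eq_one] with z h1 h2 hz
    have hz0 : z ≠ 0 := by rintro rfl; simp at hz
    have hc : (starRingEnd ℂ) z = z⁻¹ := by
      rw [Complex.inv_def, Complex.normSq_eq_norm_sq, hz]; simp
    rw [h1, h2, inner_smul_left, inner_smul_right, map_zpow₀, hc, zpow_sub₀ hz0, inv_zpow]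
    ring
  rw [integral_congr_ae h, integral_mul_const, integral_arcMeasure_zpow (sub_ne_zero.2 hmn.symm),
    zero_mul]

lemma sum_Ico_sub_shift {M : Type*} [AddCommGroup M] (u : ℤ → M) {a b : ℤ} (h : a ≤ b) :
    ∑ n ∈ Finset.Ico a b, (u (n + 1) - u n) = u b - u a := by
  induction b, h using Int.leInduction with
  | base => simp
  | succ b hb ih =>
    rw [← Finset.insert_Ico_right_eq_Ico_add_one hb, Finset.sum_insert (by simp), ih]
    abel

/-- The windows are half-open so that sums of `u (n + 1) - u n` over them telescope to `u N - u
(-N)`. -/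
lemma tendsto_Ico_neg_atTop :
    Tendsto (fun N : ℕ ↦ Finset.Ico (-(N : ℤ)) N) atTop atTop := by
  refine tendsto_atTop_finset_of_monotone (fun M N h ↦ ?_) fun n ↦ ⟨n.natAbs + 1, ?_⟩
  · exact Finset.Ico_subset_Ico (by omega) (by omega)
  · simp only [Finset.mem_Ico]; omega

/-- If `T` shifts a bilateral square-summable sequence `v` with `v 0 ≠ 0`, then on a set of `z` of
positive arc length the series `∑ z⁻ⁿ v n` yields an eigenvector of `T` with eigenvalue `z`. -/
theorem exists_eigenvector_of_shift [CompleteSpace H] (T : H →L[ℂ] H) (v : ℤ → H)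
    (hT : ∀ n, T (v n) = v (n + 1)) (hv : Summable fun n ↦ ‖v n‖ ^ 2) (h0 : v 0 ≠ 0) :
    ∃ E : Set ℂ, MeasurableSet E ∧ 0 < arcMeasure E ∧ ∀ z ∈ E, ‖z‖ = 1 ∧
      ∃ x ∈ (Submodule.span ℂ (Set.range v)).topologicalClosure, x ≠ 0 ∧ T x = z • x := by
  have hO := orthogonalFamily_zpowLp (H := H)
  -- The exponent is `-n` so that shifting the index multiplies the sum by `z` rather than `z⁻¹`.
  have hO' : OrthogonalFamily ℂ (fun _ : ℤ ↦ H)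
      fun n ↦ (zpowLp (-n) : H →ₗᵢ[ℂ] Lp H 2 arcMeasure) := hO.comp neg_injective
  obtain ⟨F, hF⟩ := (hO'.summable_iff_norm_sq_summable v).2 hv
  -- Pairing the series with its own term of index `0` leaves only `‖v 0‖²`, by orthogonality.
  have hF0 : F ≠ 0 := by
    rintro rfl
    have h1 := hF.mapL (innerSL ℂ (zpowLp (-0) (v 0)))
    have h2 := hasSum_single (f := fun n ↦ innerSL ℂ (zpowLp (-0) (v 0)) (zpowLp (-n) (v n))) 0
      fun n hn ↦ hO' (Ne.symm hn) _ _
    have h3 := h1.unique h2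
    rw [map_zero, innerSL_apply_apply, LinearIsometry.inner_map_map] at h3
    exact h0 (inner_self_eq_zero.1 h3.symm)
  set S : ℕ → ℂ → H := fun N z ↦ ∑ n ∈ Finset.Ico (-(N : ℤ)) N, z ^ (-n) • v n with hS
  have hlim := hF.comp tendsto_Ico_neg_atTop
  -- Convergence in `L²` gives pointwise convergence almost everywhere along a subsequence, which is
  -- enough.
  obtain ⟨ns, hns, hae⟩ := (tendstoInMeasure_of_tendsto_Lp hlim).exists_seq_tendsto_ae
  have hcoe : ∀ᵐ z ∂arcMeasure, ∀ N : ℕ,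
      (∑ n ∈ Finset.Ico (-(N : ℤ)) N, zpowLp (-n) (v n) : Lp H 2 arcMeasure) z = S N z := by
    rw [ae_all_iff]
    intro N
    filter_upwards [Lp.coeFn_finsetSum (Finset.Ico (-(N : ℤ)) N)
      fun n ↦ (zpowLp (-n) (v n) : Lp H 2 arcMeasure),
      ae_all_iff.2 fun n : ℤ ↦ coeFn_zpowLp (-n) (v n)] with z h1 h2
    rw [h1, Finset.sum_apply]
    exact Finset.sum_congr rfl fun n _ ↦ h2 n
  have hv0 : Tendsto (fun n ↦ ‖v n‖) cofinite (𝓝 0) := by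
    have := (Real.continuous_sqrt.tendsto 0).comp hv.tendsto_cofinite_zero
    simpa [Function.comp_def, Real.sqrt_sq] using this
  obtain ⟨t, ht, htm, htμ⟩ : ∃ t : Set ℂ, (∀ z ∈ t, ‖z‖ = 1 ∧
      Tendsto (fun k ↦ S (ns k) z) atTop (𝓝 (F z))) ∧ MeasurableSet t ∧ arcMeasure tᶜ = 0 := by
    have : ∀ᵐ z ∂arcMeasure, ‖z‖ = 1 ∧ Tendsto (fun k ↦ S (ns k) z) atTop (𝓝 (F z)) := by
      filter_upwards [ae_arcMeasure_norm_eq_one, hae, hcoe] with z h1 h2 h3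
      refine ⟨h1, h2.congr fun k ↦ ?_⟩
      rw [← h3]
      rfl
    obtain ⟨s, hs, hsm, hs0⟩ := exists_measurable_superset_of_null this
    exact ⟨sᶜ, fun z hz ↦ by_contra fun h ↦ hz (hs h), hsm.compl, by rwa [compl_compl]⟩
  refine ⟨t ∩ {z | F z ≠ 0}, htm.inter ?_, ?_, ?_⟩
  · exact ((Lp.stronglyMeasurable F).measurableSet_eq_fun stronglyMeasurable_zero).compl
  · rw [pos_iff_ne_zero]
    intro h
    refine hF0 ((Lp.eq_zero_iff_ae_eq_zero).2 ?_)
    have h2 : arcMeasure ((t ∩ {z | F z ≠ 0}) ∪ tᶜ) = 0 := by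
      rw [measure_union_null_iff]; exact ⟨h, htμ⟩
    refine measure_mono_null (fun z hz ↦ ?_) h2
    by_cases hzt : z ∈ t
    · exact Or.inl ⟨hzt, hz⟩
    · exact Or.inr hzt
  · rintro z ⟨hzt, hz0⟩
    obtain ⟨hz1, hz⟩ := ht z hzt
    have hz' : z ≠ 0 := by rintro rfl; simp at hz1
    refine ⟨hz1, F z, ?_, hz0, ?_⟩
    · refine mem_closure_of_tendsto hz (Eventually.of_forall fun k ↦ ?_)
      exact (Submodule.span ℂ (Set.range v)).sum_mem fun n _ ↦
        Submodule.smul_mem _ _ (Submodule.subset_span ⟨n, rfl⟩)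
    -- The partial sums satisfy the eigenvalue equation up to two end terms, of norms `‖v N‖` and
    -- `‖v (-N)‖`, which tend to `0`.
    · have hdiff : ∀ N : ℕ, T (S N z) - z • S N z =
          z • (z ^ (-(N : ℤ)) • v N - z ^ (-(-(N : ℤ))) • v (-N)) := by
        intro N
        rw [← sum_Ico_sub_shift (fun n ↦ z ^ (-n) • v n) (by omega : -(N : ℤ) ≤ N),
          Finset.smul_sum]
        simp only [hS, map_sum, Finset.smul_sum, ← Finset.sum_sub_distrib]
        refine Finset.sum_congr rfl fun n _ ↦ ?_
        have e : z * z ^ (-(n + 1)) = z ^ (-n) := by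
          rw [← zpow_one_add₀ hz']
          congr 1
          ring
        rw [map_smul, hT, smul_sub, smul_smul z (z ^ (-(n + 1))), e]
      have h1 : Tendsto (fun k ↦ T (S (ns k) z) - z • S (ns k) z) atTop
          (𝓝 (T (F z) - z • F z)) :=
        ((T.continuous.tendsto _).comp hz).sub (hz.const_smul z)
      have h2 : Tendsto (fun N : ℕ ↦ T (S N z) - z • S N z) atTop (𝓝 0) := by
        have ha : Tendsto (fun N : ℕ ↦ ‖v N‖ + ‖v (-N)‖) atTop (𝓝 0) := by
          rw [← add_zero (0 : ℝ), ← Nat.cofinite_eq_atTop]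
          exact (hv0.comp Nat.cast_injective.tendsto_cofinite).add
            (hv0.comp (neg_injective.comp Nat.cast_injective).tendsto_cofinite)
        refine squeeze_zero_norm (fun N ↦ ?_) ha
        rw [hdiff, norm_smul, hz1, one_mul]
        refine (norm_sub_le _ _).trans (le_of_eq ?_)
        simp [norm_smul, hz1]
      exact sub_eq_zero.1 (tendsto_nhds_unique h1 (h2.comp hns.tendsto_atTop))

end Fourier

/-! ### Parseval's identity and the Hilbert space structure of `H²` -/

lemma hasSum_circleAverage {F : ℕ → ℂ → ℂ} {f : ℂ → ℂ} {r : ℝ} (hr : 0 ≤ r) {b : ℕ → ℝ}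
    (hF : ∀ n, ContinuousOn (F n) (sphere 0 r)) (hb : ∀ n, ∀ z ∈ sphere (0 : ℂ) r, ‖F n z‖ ≤ b n)
    (hs : Summable b) (h : ∀ z ∈ sphere (0 : ℂ) r, HasSum (fun n ↦ F n z) (f z)) :
    HasSum (fun n ↦ Real.circleAverage (F n) 0 r) (Real.circleAverage f 0 r) := by
  have hm : ∀ θ, circleMap 0 r θ ∈ sphere (0 : ℂ) r := circleMap_mem_sphere 0 hr
  simp only [Real.circleAverage_def]
  refine HasSum.const_smul _ ?_
  refine intervalIntegral.hasSum_integral_of_dominated_convergence (fun n _ ↦ b n) (fun n ↦ ?_)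
    (fun n ↦ Eventually.of_forall fun θ _ ↦ hb n _ (hm θ)) (Eventually.of_forall fun _ _ ↦ hs) ?_
    (Eventually.of_forall fun θ _ ↦ h _ (hm θ))
  · exact ((hF n).comp_continuous (continuous_circleMap 0 r) hm).aestronglyMeasurable
  · exact continuous_const.intervalIntegrable _ _

lemma circleAverage_pow_mul_conj_pow (n m : ℕ) {r : ℝ} (hr : 0 ≤ r) :
    Real.circleAverage (fun z : ℂ ↦ z ^ n * conj z ^ m) 0 r = if n = m then (r : ℂ) ^ (2 * m)
      else 0 := by
  have hc : ∀ z : ℂ, z ∈ sphere (0 : ℂ) |r| → z * conj z = (r : ℂ) ^ 2 := fun z hz ↦ by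
    rw [Complex.mul_conj, Complex.normSq_eq_norm_sq, mem_sphere_zero_iff_norm.1 hz]
    simp
  split_ifs with h
  · subst h
    refine (Real.circleAverage_congr_sphere (f₂ := fun _ ↦ (r : ℂ) ^ (2 * n)) fun z hz ↦ ?_).trans
      (Real.circleAverage_const _ 0 r)
    beta_reduce
    rw [← mul_pow, hc z hz, ← pow_mul]
  -- For `r > 0` the integrand is `r ^ (2m) z ^ (n - m)` on the circle; this needs `z ≠ 0`, so `r =
  -- 0` is separate.
  · rcases hr.eq_or_lt with rfl | hr
    · refine (Real.circleAverage_congr_sphere (f₂ := fun _ ↦ (0 : ℂ)) fun z hz ↦ ?_).trans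
        (Real.circleAverage_const _ 0 0)
      obtain rfl : z = 0 := by simpa using hz
      by_cases hn : n = 0
      · simp [show m ≠ 0 by omega]
      · simp [hn]
    · have h1 : Set.EqOn (fun z : ℂ ↦ z ^ n * conj z ^ m)
          (fun z ↦ ((r : ℂ) ^ (2 * m)) • z ^ ((n : ℤ) - m)) (sphere 0 |r|) := by
        intro z hz
        have hz0 : z ≠ 0 := by
          rintro rfl
          simp [eq_comm, hr.ne'] at hz
        simp only [smul_eq_mul]
        rw [zpow_sub₀ hz0, zpow_natCast, zpow_natCast, pow_mul, ← hc z hz, mul_pow]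
        field_simp
      rw [Real.circleAverage_congr_sphere h1, Real.circleAverage_fun_smul,
        circleAverage_zpow (by omega) hr, smul_zero]

/-- Parseval's identity. -/
lemma hasSum_sqMean {f : UnitDisc → ℂ} {a : ℕ → ℂ}
    (h : ∀ z ∈ ball (0 : ℂ) 1, HasSum (fun n ↦ a n * z ^ n) (extend f z)) {r : ℝ}
    (hr : r ∈ Set.Ico (0 : ℝ) 1) :
    HasSum (fun n ↦ ‖a n‖ ^ 2 * r ^ (2 * n)) (sqMean f r) := by
  have hsub : ∀ z ∈ sphere (0 : ℂ) r, z ∈ ball (0 : ℂ) 1 := fun z hz ↦ sphere_subset_ball hr.2 hz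
  have hsum : Summable fun n ↦ ‖a n‖ * r ^ n := by
    have := (h (r : ℂ) (by simpa [abs_of_nonneg hr.1] using hr.2)).summable.norm
    simpa [abs_of_nonneg hr.1] using this
  set M : ℝ := ∑' n, ‖a n‖ * r ^ n
  have hnorm : ∀ z ∈ sphere (0 : ℂ) r, ∀ n, ‖a n * z ^ n‖ = ‖a n‖ * r ^ n := fun z hz n ↦ by
    rw [norm_mul, norm_pow, mem_sphere_zero_iff_norm.1 hz]
  have hM : ∀ z ∈ sphere (0 : ℂ) r, ‖extend f z‖ ≤ M := fun z hz ↦ by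
    rw [← (h z (hsub z hz)).tsum_eq]
    exact tsum_of_norm_bounded hsum.hasSum fun n ↦ (hnorm z hz n).le
  have hfc : ContinuousOn (extend f) (sphere 0 r) := by
    have : ContinuousOn (fun z : ℂ ↦ ∑' n, a n * z ^ n) (sphere 0 r) :=
      continuousOn_tsum (fun n ↦ by fun_prop) hsum fun n z hz ↦ (hnorm z hz n).le
    exact this.congr fun z hz ↦ (h z (hsub z hz)).tsum_eq.symm
  have h1 : ∀ m : ℕ, Real.circleAverage (fun z ↦ extend f z * conj z ^ m) 0 r =
      a m * (r : ℂ) ^ (2 * m) := by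
    intro m
    have key := hasSum_circleAverage (F := fun n z ↦ a n * z ^ n * conj z ^ m)
      (f := fun z ↦ extend f z * conj z ^ m) hr.1 (fun n ↦ by fun_prop)
      (fun n z hz ↦ le_of_eq (by
        rw [norm_mul, hnorm z hz, norm_pow, Complex.norm_conj, mem_sphere_zero_iff_norm.1 hz]))
      (hsum.mul_right (r ^ m)) fun z hz ↦ (h z (hsub z hz)).mul_right _
    refine key.unique ?_
    have e : (fun n ↦ Real.circleAverage (fun z : ℂ ↦ a n * z ^ n * conj z ^ m) 0 r) =
        fun n ↦ if n = m then a m * (r : ℂ) ^ (2 * m) else 0 := by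
      funext n
      have := Real.circleAverage_fun_smul (𝕜 := ℂ) (a := a n) (f := fun z : ℂ ↦ z ^ n * conj z ^ m)
        (c := 0) (R := r)
      simp only [smul_eq_mul, ← mul_assoc] at this
      rw [this, circleAverage_pow_mul_conj_pow n m hr.1]
      split_ifs with hnm <;> simp [hnm]
    rw [e]
    exact hasSum_ite_eq m _
  -- Only the conjugate factor of `|f|² = f · conj f` is expanded; `h1` evaluates each term, so no
  -- double series arises.
  have key := hasSum_circleAverage (F := fun m z ↦ conj (a m) * (extend f z * conj z ^ m))
      (f := fun z ↦ ((‖extend f z‖ ^ 2 : ℝ) : ℂ)) hr.1 (fun m ↦ by fun_prop)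
      (b := fun m ↦ M * (‖a m‖ * r ^ m))
      (fun m z hz ↦ by
        rw [norm_mul, norm_mul, norm_pow, Complex.norm_conj, Complex.norm_conj,
          mem_sphere_zero_iff_norm.1 hz, mul_left_comm]
        gcongr
        · exact mul_nonneg (norm_nonneg _) (pow_nonneg hr.1 _)
        · exact hM z hz)
      (hsum.mul_left M) fun z hz ↦ by
        have := ((Complex.hasSum_conj'.2 (h z (hsub z hz)))).mul_left (extend f z)
        rw [Complex.mul_conj, Complex.normSq_eq_norm_sq] at this
        refine this.congr_fun fun m ↦ ?_
        simp
        ring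
  have e2 : Real.circleAverage (fun z ↦ ((‖extend f z‖ ^ 2 : ℝ) : ℂ)) 0 r = (sqMean f r : ℝ) := by
    have hi : CircleIntegrable (fun z ↦ ‖extend f z‖ ^ 2) 0 r :=
      (hfc.norm.pow 2).circleIntegrable hr.1
    exact ContinuousLinearMap.circleAverage_comp_comm Complex.ofRealCLM hi
  rw [e2] at key
  refine Complex.hasSum_ofReal.1 (key.congr_fun fun m ↦ ?_)
  have e := Real.circleAverage_fun_smul (𝕜 := ℂ) (a := conj (a m))
    (f := fun z : ℂ ↦ extend f z * conj z ^ m) (c := 0) (R := r)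
  simp only [smul_eq_mul] at e
  rw [e, h1, ← mul_assoc, mul_comm (conj (a m)), Complex.mul_conj, Complex.normSq_eq_norm_sq]
  push_cast
  rfl

lemma IsHolo.exists_hasSum {f : UnitDisc → ℂ} (hf : IsHolo f) :
    ∃ a : ℕ → ℂ, ∀ z ∈ ball (0 : ℂ) 1, HasSum (fun n ↦ a n * z ^ n) (extend f z) := by
  refine ⟨fun n ↦ (n.factorial : ℂ)⁻¹ * iteratedDeriv n (extend f) 0, fun z hz ↦ ?_⟩
  refine (Complex.hasSum_taylorSeries_on_ball hf hz).congr_fun fun n ↦ ?_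
  simp
  ring

lemma IsHolo.sqMean_mono {f : UnitDisc → ℂ} (hf : IsHolo f) {r s : ℝ} (hr : 0 ≤ r) (hrs : r ≤ s)
    (hs : s < 1) : sqMean f r ≤ sqMean f s := by
  obtain ⟨a, ha⟩ := hf.exists_hasSum
  refine hasSum_le (fun n ↦ ?_) (hasSum_sqMean ha ⟨hr, hrs.trans_lt hs⟩)
    (hasSum_sqMean ha ⟨hr.trans hrs, hs⟩)
  gcongr

/-- The means increase with the radius, so their supremum is a limit. Unlike suprema, limits add, so
several norms can be bounded together on a common circle. -/
lemma H2.tendsto_sqMean (f : H2) : Tendsto (sqMean f) (𝓝[<] 1) (𝓝 (‖f‖ ^ 2)) := by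
  refine tendsto_order.2 ⟨fun A hA ↦ ?_, fun A hA ↦ ?_⟩
  · obtain ⟨r, hr, h⟩ : ∃ r ∈ Set.Ico (0 : ℝ) 1, A < sqMean f r := by
      by_contra! h
      exact absurd (f.norm_sq_le h) (not_le.2 hA)
    filter_upwards [Ioo_mem_nhdsLT hr.2] with s hs
    exact h.trans_le (f.isHolo.sqMean_mono hr.1 hs.1.le hs.2)
  · filter_upwards [Ioo_mem_nhdsLT zero_lt_one] with s hs
    exact (f.sqMean_le ⟨hs.1.le, hs.2⟩).trans_lt hA

/-- A bound on a finite sum of squared norms follows from the bounds on every circle. -/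
lemma H2.sum_norm_sq_le {ι : Type*} (s : Finset ι) (f : ι → H2) {A : ℝ}
    (h : ∀ r ∈ Set.Ico (0 : ℝ) 1, ∑ i ∈ s, sqMean (f i) r ≤ A) : ∑ i ∈ s, ‖f i‖ ^ 2 ≤ A := by
  refine le_of_tendsto (tendsto_finsetSum s fun i _ ↦ (f i).tendsto_sqMean) ?_
  filter_upwards [Ioo_mem_nhdsLT zero_lt_one] with r hr using h r ⟨hr.1.le, hr.2⟩

lemma sqMean_le_tsum {f : UnitDisc → ℂ} {a : ℕ → ℂ}
    (h : ∀ z ∈ ball (0 : ℂ) 1, HasSum (fun n ↦ a n * z ^ n) (extend f z))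
    (ha : Summable fun n ↦ ‖a n‖ ^ 2) {r : ℝ} (hr : r ∈ Set.Ico (0 : ℝ) 1) :
    sqMean f r ≤ ∑' n, ‖a n‖ ^ 2 := by
  refine hasSum_le (fun n ↦ ?_) (hasSum_sqMean h hr) ha.hasSum
  exact mul_le_of_le_one_right (by positivity) (pow_le_one₀ hr.1 hr.2.le)

lemma H2.hasSum_norm_sq {f : H2} {a : ℕ → ℂ}
    (h : ∀ z ∈ ball (0 : ℂ) 1, HasSum (fun n ↦ a n * z ^ n) (extend f z)) :
    HasSum (fun n ↦ ‖a n‖ ^ 2) (‖f‖ ^ 2) := by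
  -- Parseval's identity on each circle bounds a finite partial sum, in which `r → 1` is harmless.
  have hle : ∀ s : Finset ℕ, ∑ n ∈ s, ‖a n‖ ^ 2 ≤ ‖f‖ ^ 2 := by
    intro s
    have hc : Tendsto (fun r : ℝ ↦ ∑ n ∈ s, ‖a n‖ ^ 2 * r ^ (2 * n)) (𝓝[<] 1)
        (𝓝 (∑ n ∈ s, ‖a n‖ ^ 2)) := by
      have : Continuous fun r : ℝ ↦ ∑ n ∈ s, ‖a n‖ ^ 2 * r ^ (2 * n) := by fun_prop
      simpa using (this.tendsto 1).mono_left nhdsWithin_le_nhds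
    refine le_of_tendsto hc ?_
    filter_upwards [Ioo_mem_nhdsLT zero_lt_one] with r hr
    have hr' : r ∈ Set.Ico (0 : ℝ) 1 := ⟨hr.1.le, hr.2⟩
    exact (sum_le_hasSum s (fun n _ ↦ by have := hr'.1; positivity) (hasSum_sqMean h hr')).trans
      (f.sqMean_le hr')
  have hs : Summable fun n ↦ ‖a n‖ ^ 2 := summable_of_sum_le (fun _ ↦ by positivity) hle
  have : ‖f‖ ^ 2 = ∑' n, ‖a n‖ ^ 2 :=
    le_antisymm (f.norm_sq_le fun r hr ↦ sqMean_le_tsum h hs hr)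
      (hs.tsum_le_of_sum_le hle)
  rw [this]
  exact hs.hasSum

section PowerSeries

lemma summable_lp_mul_pow (a : lp (fun _ : ℕ ↦ ℂ) 2) {z : ℂ} (hz : ‖z‖ < 1) :
    Summable fun n ↦ a n * z ^ n := by
  refine Summable.of_norm_bounded
    ((summable_geometric_of_lt_one (norm_nonneg z) hz).mul_left ‖a‖) fun n ↦ ?_
  rw [norm_mul, norm_pow]
  gcongr
  exact lp.norm_apply_le_norm two_ne_zero a n

lemma extend_tsum (a : lp (fun _ : ℕ ↦ ℂ) 2) {z : ℂ} (hz : z ∈ ball (0 : ℂ) 1) :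
    extend (fun z : UnitDisc ↦ ∑' n, a n * (z : ℂ) ^ n) z = ∑' n, a n * z ^ n := by
  lift z to UnitDisc using by simpa using hz
  rw [extend_coe]

lemma hasSum_extend_tsum (a : lp (fun _ : ℕ ↦ ℂ) 2) {z : ℂ} (hz : z ∈ ball (0 : ℂ) 1) :
    HasSum (fun n ↦ a n * z ^ n) (extend (fun z : UnitDisc ↦ ∑' n, a n * (z : ℂ) ^ n) z) := by
  rw [extend_tsum a hz]
  exact (summable_lp_mul_pow a (by simpa using hz)).hasSum

lemma lp_hasSum_norm_sq (a : lp (fun _ : ℕ ↦ ℂ) 2) : HasSum (fun n ↦ ‖a n‖ ^ 2) (‖a‖ ^ 2) := by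
  simpa using lp.hasSum_norm (by norm_num) a

lemma isHolo_tsum (a : lp (fun _ : ℕ ↦ ℂ) 2) :
    IsHolo fun z : UnitDisc ↦ ∑' n, a n * (z : ℂ) ^ n := by
  refine DifferentiableOn.congr (f := fun z ↦ ∑' n, a n * z ^ n) ?_ fun z hz ↦ extend_tsum a hz
  intro z hz
  obtain ⟨ρ, h1, h2⟩ := exists_between (show ‖z‖ < 1 by simpa using hz)
  have hd : DifferentiableOn ℂ (fun z : ℂ ↦ ∑' n, a n * z ^ n) (ball 0 ρ) := by
    refine Complex.differentiableOn_tsum_of_summable_norm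
      ((summable_geometric_of_lt_one ((norm_nonneg z).trans h1.le) h2).mul_left ‖a‖)
      (fun n ↦ by fun_prop) isOpen_ball fun n w hw ↦ ?_
    rw [norm_mul, norm_pow]
    have hw' : ‖w‖ ≤ ρ := by simpa using (mem_ball.1 hw).le
    gcongr
    exact lp.norm_apply_le_norm two_ne_zero a n
  exact (hd.differentiableAt (isOpen_ball.mem_nhds (by simpa using h1))).differentiableWithinAt

/-- The power series with coefficients `a`, as a linear isometric equivalence `ℓ² ≃ H²`. -/
def lpEquiv : lp (fun _ : ℕ ↦ ℂ) 2 ≃ₗᵢ[ℂ] H2 :=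
  LinearIsometryEquiv.ofSurjective
    { toFun := fun a ↦ ⟨fun z ↦ ∑' n, a n * (z : ℂ) ^ n, isHolo_tsum a, ∑' n, ‖a n‖ ^ 2, by
        rintro _ ⟨r, rfl⟩
        exact sqMean_le_tsum (fun z hz ↦ hasSum_extend_tsum a hz)
          (lp_hasSum_norm_sq a).summable r.2⟩
      map_add' := fun a b ↦ H2.ext fun z ↦ by
        have h1 := summable_lp_mul_pow a z.norm_lt_one
        have h2 := summable_lp_mul_pow b z.norm_lt_one
        refine Eq.trans ?_ (h1.tsum_add h2)
        exact tsum_congr fun n ↦ add_mul _ _ _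
      map_smul' := fun c a ↦ H2.ext fun z ↦ by
        refine Eq.trans ?_ (tsum_mul_left (a := c) (f := fun n ↦ a n * (z : ℂ) ^ n))
        exact tsum_congr fun n ↦ mul_assoc _ _ _
      norm_map' := fun a ↦ by
        refine (sq_eq_sq₀ (norm_nonneg _) (norm_nonneg _)).1 ?_
        exact (H2.hasSum_norm_sq fun z hz ↦ hasSum_extend_tsum a hz).unique (lp_hasSum_norm_sq a) }
    fun f ↦ by
      obtain ⟨a, ha⟩ := f.isHolo.exists_hasSum
      have hs := (H2.hasSum_norm_sq ha).summable
      refine ⟨⟨a, memℓp_gen (by simpa using hs)⟩, H2.ext fun z ↦ ?_⟩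
      have := ha z (by simpa using z.norm_lt_one)
      rw [extend_coe] at this
      exact this.tsum_eq

end PowerSeries

namespace H2

/-- The inner product is transported from `ℓ²`; as `lpEquiv` is isometric, it induces the norm
already defined by integral means. -/
instance : InnerProductSpace ℂ H2 where
  inner f g := ⟪lpEquiv.symm f, lpEquiv.symm g⟫_ℂ
  norm_sq_eq_re_inner f := by
    rw [← lpEquiv.symm.norm_map f]
    exact norm_sq_eq_re_inner _
  conj_inner_symm f g := inner_conj_symm _ _
  add_left f g h := by rw [map_add, inner_add_left]
  smul_left f g c := by rw [map_smul, inner_smul_left]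

instance : CompleteSpace H2 :=
  lpEquiv.toIsometryEquiv.completeSpace_iff.1 inferInstance

end H2

/-! ### Poisson kernels along the orbit of a hyperbolic automorphism -/

/-- Subordination: a composition is dominated on circles by a Poisson integral over the unit
circle. -/
lemma circleAverage_norm_comp_le {h : ℂ → ℂ} (hh : DiffContOnCl ℂ h (ball 0 1))
    {φ : UnitDisc → UnitDisc} (hφ : IsHoloMap φ) {s : ℝ} (hs : s ∈ Set.Ico (0 : ℝ) 1) :
    Real.circleAverage (fun z ↦ ‖h (extend (fun z ↦ (φ z : ℂ)) z)‖) 0 s ≤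
      Real.circleAverage (fun z ↦ (herglotzRieszKernel 0 (φ 0 : ℂ) z).re * ‖h z‖) 0 1 := by
  set Φ : ℂ → ℂ := extend fun z ↦ (φ z : ℂ) with hΦ
  have hsub : closedBall (0 : ℂ) s ⊆ ball 0 1 := closedBall_subset_ball hs.2
  have h00 : (0 : ℂ) ∈ closedBall (0 : ℂ) s := by simpa using hs.1
  have hΦ0 : Φ 0 = φ 0 := by simpa using extend_coe (fun z ↦ (φ z : ℂ)) 0
  have hmaps : ∀ z ∈ closedBall (0 : ℂ) s, Φ z ∈ ball (0 : ℂ) 1 := fun z hz ↦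
    extend_mem_ball φ (hsub hz)
  have hc : ContinuousOn (fun z ↦ ‖h z‖) (sphere 0 |1|) := by
    rw [abs_one]
    exact (hh.continuousOn_ball.mono sphere_subset_closedBall).norm
  have hi : CircleIntegrable (fun z ↦ ‖h z‖) 0 1 := hc.circleIntegrable'
  -- The triangle inequality in Poisson's formula, whose kernel is nonnegative.
  have hpois : ∀ w ∈ ball (0 : ℂ) 1, ‖h w‖ ≤
      Real.circleAverage (fun z ↦ (herglotzRieszKernel 0 w z).re * ‖h z‖) 0 1 := by
    intro w hw
    have h1 := hh.circleAverage_re_herglotzRieszKernel_smul hw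
    nth_rw 1 [← h1]
    simp only [Real.circleAverage_def, norm_smul]
    rw [smul_eq_mul, Real.norm_of_nonneg (by positivity)]
    refine mul_le_mul_of_nonneg_left ?_ (by positivity)
    refine (intervalIntegral.norm_integral_le_integral_norm (by positivity)).trans (le_of_eq ?_)
    refine intervalIntegral.integral_congr fun θ _ ↦ ?_
    have hθ : circleMap 0 1 θ ∈ sphere (0 : ℂ) 1 := circleMap_mem_sphere 0 zero_le_one θ
    have hw' : ‖w‖ < 1 := by simpa using hw
    have hpos : 0 ≤ (herglotzRieszKernel 0 w (circleMap 0 1 θ)).re := by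
      refine le_trans ?_ (le_re_herglotzRieszKernel hθ hw)
      rw [sub_zero]
      exact div_nonneg (by linarith) (by linarith [norm_nonneg w])
    simp [abs_of_nonneg hpos]
  -- A holomorphic function whose real part is the Poisson integral of `|h|`. The mean value
  -- property of `K ∘ Φ` evaluates the average of this majorant as its value at `φ 0`.
  set K : ℂ → ℂ := fun w ↦ Real.circleAverage
    (fun z ↦ herglotzRieszKernel 0 w z • ((‖h z‖ : ℝ) : ℂ)) 0 1 with hK
  have hKre : ∀ w ∈ ball (0 : ℂ) 1, (K w).re =
      Real.circleAverage (fun z ↦ (herglotzRieszKernel 0 w z).re * ‖h z‖) 0 1 :=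
    fun w hw ↦ re_circleAverage_herglotzRieszKernel_smul hi hw
  have hKd : DifferentiableOn ℂ K (ball 0 1) := by
    refine differentiableOn_circleAverage_herglotzRieszKernel_smul ?_
    exact ContinuousOn.circleIntegrable' (Complex.continuous_ofReal.comp_continuousOn hc)
  have hKΦ : DifferentiableOn ℂ (K ∘ Φ) (closedBall 0 s) := hKd.comp (hφ.mono hsub) hmaps
  have hcont : ContinuousOn (K ∘ Φ) (sphere 0 |s|) := by
    rw [abs_of_nonneg hs.1]
    exact hKΦ.continuousOn.mono sphere_subset_closedBall
  have hmean : Real.circleAverage (K ∘ Φ) 0 s = K (Φ 0) := by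
    refine DiffContOnCl.circleAverage ?_
    rw [abs_of_nonneg hs.1]
    exact ⟨hKΦ.mono ball_subset_closedBall,
      hKΦ.continuousOn.mono closure_ball_subset_closedBall⟩
  have hmean' : Real.circleAverage (fun z ↦ (K (Φ z)).re) 0 s = (K (Φ 0)).re := by
    rw [← hmean]
    exact ContinuousLinearMap.circleAverage_comp_comm Complex.reCLM hcont.circleIntegrable'
  rw [← hΦ0, ← hKre _ (hmaps 0 h00), ← hmean']
  refine Real.circleAverage_mono ?_
    (Complex.continuous_re.comp_continuousOn hcont).circleIntegrable' fun z hz ↦ ?_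
  · refine ContinuousOn.circleIntegrable hs.1 (ContinuousOn.norm ?_)
    exact hh.continuousOn_ball.comp
      (hφ.continuousOn.mono (sphere_subset_closedBall.trans hsub))
      fun z hz ↦ ball_subset_closedBall (hmaps z (sphere_subset_closedBall hz))
  · rw [abs_of_nonneg hs.1] at hz
    have hz' := hmaps z (sphere_subset_closedBall hz)
    rw [hKre _ hz']
    exact hpois _ hz'

lemma cayleyInv_zpow {μ : ℝ} {φ : DiscAut} (hφ : IsCanonicalHyperbolic μ φ) (n : ℤ)
    (z : UnitDisc) : cayleyInv ((φ ^ n : DiscAut) z) = (μ : ℂ) ^ n * cayleyInv z := by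
  have hμ : (μ : ℂ) ≠ 0 := by
    have := hφ.1
    exact_mod_cast (by positivity : μ ≠ 0)
  induction n generalizing z with
  | zero => simp
  | succ n ih =>
    rw [zpow_add_one, zpow_add_one₀ hμ, mul_assoc, ← hφ.2]
    exact ih (φ z)
  | pred n ih =>
    have h : cayleyInv ((φ⁻¹ : DiscAut) z) = (μ : ℂ)⁻¹ * cayleyInv z := by
      rw [eq_inv_mul_iff_mul_eq₀ hμ, ← hφ.2]
      congr 1
      exact φ.1.apply_symm_apply z
    rw [zpow_sub_one, zpow_sub_one₀ hμ, mul_assoc, ← h]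
    exact ih _

lemma eq_of_cayleyInv_eq {w : UnitDisc} {m : ℝ} (hm : 0 < m) (h : cayleyInv w = m) :
    (w : ℂ) = ((m - 1) / (m + 1) : ℝ) := by
  have h1 : (1 : ℂ) - w ≠ 0 := by
    intro h0
    have := w.norm_lt_one
    rw [← sub_eq_zero.1 h0] at this
    simp at this
  have h2 : (m : ℂ) + 1 ≠ 0 := by exact_mod_cast (by positivity : m + 1 ≠ 0)
  rw [cayleyInv, div_eq_iff h1] at h
  push_cast
  rw [eq_div_iff h2]
  linear_combination h

/-- The value of the Poisson kernel for a real point, in half-plane coordinates. -/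
lemma re_herglotzRieszKernel_mul_norm {m : ℝ} (hm : 0 < m) {z : ℂ} (hz : ‖z‖ = 1) :
    (herglotzRieszKernel 0 ((m - 1) / (m + 1) : ℝ) z).re * ‖z ^ 2 - 1‖ =
      4 * (m * √(1 - z.re)) * √(1 + z.re) / ((m * √(1 - z.re)) ^ 2 + √(1 + z.re) ^ 2) := by
  have hxy : z.re ^ 2 + z.im ^ 2 = 1 := by
    have := Complex.sq_norm z
    rw [hz, Complex.normSq_apply] at this
    linarith
  obtain ⟨hx1, hx2⟩ : -1 ≤ z.re ∧ z.re ≤ 1 := abs_le.1 (hz ▸ Complex.abs_re_le_norm z)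
  have hp : √(1 - z.re) ^ 2 = 1 - z.re := Real.sq_sqrt (by linarith)
  have hq : √(1 + z.re) ^ 2 = 1 + z.re := Real.sq_sqrt (by linarith)
  -- On the unit circle `|1 ∓ z|² = 2(1 ∓ Re z)`.
  have hn : ‖z ^ 2 - 1‖ = 2 * (√(1 - z.re) * √(1 + z.re)) := by
    refine (sq_eq_sq₀ (norm_nonneg _) (by positivity)).1 ?_
    rw [mul_pow, mul_pow, hp, hq, Complex.sq_norm, Complex.normSq_apply]
    simp only [pow_two, Complex.sub_re, Complex.sub_im, Complex.mul_re, Complex.mul_im,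
      Complex.one_re, Complex.one_im]
    linear_combination (z.re ^ 2 + z.im ^ 2 + 3) * hxy
  have hk : (herglotzRieszKernel 0 ((m - 1) / (m + 1) : ℝ) z).re =
      2 * m / (m ^ 2 * (1 - z.re) + (1 + z.re)) := by
    have := congrFun (poissonKernel_eq_re_herglotzRieszKernel (c := 0)
      (w := ((m - 1) / (m + 1) : ℝ))) z
    rw [Function.comp_apply] at this
    rw [← this, poissonKernel_def]
    simp only [sub_zero]
    rw [hz, Complex.sq_norm (z - _), Complex.normSq_apply, Complex.norm_real, Real.norm_eq_abs,
      sq_abs]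
    simp only [Complex.sub_re, Complex.sub_im, Complex.ofReal_re, Complex.ofReal_im, sub_zero]
    have hy : z.im * z.im = 1 - z.re ^ 2 := by linarith
    rw [hy]
    have e1 : (z.re - (m - 1) / (m + 1)) * (z.re - (m - 1) / (m + 1)) + (1 - z.re ^ 2) =
        2 * (m ^ 2 * (1 - z.re) + (1 + z.re)) / (m + 1) ^ 2 := by
      field_simp
      ring
    have e2 : (1 : ℝ) ^ 2 - ((m - 1) / (m + 1)) ^ 2 = 4 * m / (m + 1) ^ 2 := by
      field_simp
      ring
    rw [e1, e2, div_div_div_cancel_right₀ (by positivity), show 4 * m = 2 * (2 * m) by ring,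
      mul_div_mul_left _ _ two_ne_zero]
  rw [hk, hn, mul_pow, hp, hq]
  ring

/-- The right side makes the sum over `X = μⁿ p` telescope. The difference in brackets is `(μ - 1)Xq
/ ((μX + q)(X + q))`, and `(μX + q)(X + q) ≤ μ(X + q)² ≤ 2μ(X² + q²)`. -/
lemma four_mul_div_le {μ X q : ℝ} (hμ : 1 < μ) (hX : 0 ≤ X) (hq : 0 ≤ q) :
    4 * X * q / (X ^ 2 + q ^ 2) ≤
      8 * μ / (μ - 1) * (μ * X / (μ * X + q) - X / (X + q)) := by
  have h1 : 0 < μ - 1 := by linarith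
  rcases hX.eq_or_lt with rfl | hX
  · simp
  have e : 8 * μ / (μ - 1) * (μ * X / (μ * X + q) - X / (X + q)) =
      8 * μ * X * q / ((μ * X + q) * (X + q)) := by
    field_simp
    ring
  rw [e, div_le_div_iff₀ (by positivity) (by positivity)]
  have h2 : (μ * X + q) * (X + q) ≤ 2 * μ * (X ^ 2 + q ^ 2) := by
    nlinarith [mul_nonneg h1.le hq, mul_nonneg (mul_nonneg h1.le hq) hX.le,
      mul_nonneg (by linarith : 0 ≤ μ) (sq_nonneg (X - q)), mul_nonneg h1.le (sq_nonneg q)]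
  have h3 : 0 ≤ 4 * X * q := by positivity
  nlinarith

lemma sum_shift_sub_le {u : ℤ → ℝ} (hu : Monotone u) (h0 : ∀ n, 0 ≤ u n) (h1 : ∀ n, u n ≤ 1)
    (s : Finset ℤ) : ∑ n ∈ s, (u (n + 1) - u n) ≤ 1 := by
  obtain ⟨N, hN⟩ := (tendsto_Ico_neg_atTop.eventually_ge_atTop s).exists
  refine (Finset.sum_le_sum_of_subset_of_nonneg hN fun n _ _ ↦
    sub_nonneg.2 (hu (by omega))).trans ?_
  rw [sum_Ico_sub_shift u (by omega)]
  linarith [h0 (-(N : ℤ)), h1 N]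

lemma sum_four_mul_div_le {μ p q : ℝ} (hμ : 1 < μ) (hp : 0 ≤ p) (hq : 0 ≤ q) (s : Finset ℤ) :
    ∑ n ∈ s, 4 * (μ ^ n * p) * q / ((μ ^ n * p) ^ 2 + q ^ 2) ≤ 8 * μ / (μ - 1) := by
  have hμ0 : 0 < μ := by linarith
  have hC : 0 ≤ 8 * μ / (μ - 1) := div_nonneg (by positivity) (by linarith)
  set u : ℤ → ℝ := fun n ↦ μ ^ n * p / (μ ^ n * p + q) with hu
  have hstep : ∀ n, 4 * (μ ^ n * p) * q / ((μ ^ n * p) ^ 2 + q ^ 2) ≤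
      8 * μ / (μ - 1) * (u (n + 1) - u n) := fun n ↦ by
    have := four_mul_div_le (X := μ ^ n * p) hμ (by positivity) hq
    rwa [← mul_assoc μ, ← zpow_one_add₀ hμ0.ne', add_comm 1 n] at this
  -- The increments are nonnegative because `hstep` bounds them below by nonnegative quantities, up
  -- to a positive factor.
  have hmono : Monotone u := by
    refine monotone_int_of_le_succ fun n ↦ sub_nonneg.1 ?_
    refine nonneg_of_mul_nonneg_right ((div_nonneg ?_ ?_).trans (hstep n))
      (div_pos (by positivity) (by linarith))
    all_goals positivity
  calc _ ≤ ∑ n ∈ s, 8 * μ / (μ - 1) * (u (n + 1) - u n) := Finset.sum_le_sum fun n _ ↦ hstep n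
    _ ≤ _ := by
      rw [← Finset.mul_sum]
      refine mul_le_of_le_one_right hC (sum_shift_sub_le hmono (fun n ↦ ?_) (fun n ↦ ?_) s)
      · positivity
      · exact div_le_one_of_le₀ (by linarith) (by positivity)

/-- The Poisson kernels at the points of the orbit of `0` add up to at most a multiple of
`1 / |z² - 1|`. -/
lemma sum_re_herglotzRieszKernel_mul_le {μ : ℝ} {φ : DiscAut} (hφ : IsCanonicalHyperbolic μ φ)
    (s : Finset ℤ) {z : ℂ} (hz : ‖z‖ = 1) :
    ∑ n ∈ s, (herglotzRieszKernel 0 ((φ ^ n : DiscAut) 0 : ℂ) z).re * ‖z ^ 2 - 1‖ ≤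
      8 * μ / (μ - 1) := by
  have hμ0 : 0 < μ := by linarith [hφ.1]
  refine le_trans (le_of_eq (Finset.sum_congr rfl fun n _ ↦ ?_))
    (sum_four_mul_div_le hφ.1 (Real.sqrt_nonneg (1 - z.re)) (Real.sqrt_nonneg (1 + z.re)) s)
  have h : cayleyInv ((φ ^ n : DiscAut) 0) = ((μ ^ n : ℝ) : ℂ) := by
    rw [cayleyInv_zpow hφ]
    simp [cayleyInv]
  rw [eq_of_cayleyInv_eq (zpow_pos hμ0 n) h, re_herglotzRieszKernel_mul_norm (zpow_pos hμ0 n) hz]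

/-! ### Square-summability of the orbit -/

/-- Only `g` is dilated: the factor `z² - 1` must stay intact on the unit circle to absorb the sum
of Poisson kernels. -/
lemma diffContOnCl_dilate (g : H2) {ρ : ℝ} (hρ : ρ ∈ Set.Ioo (0 : ℝ) 1) :
    DiffContOnCl ℂ (fun z ↦ (z ^ 2 - 1) * extend g (ρ * z) ^ 2) (ball 0 1) := by
  refine DifferentiableOn.diffContOnCl ?_
  rw [closure_ball _ one_ne_zero]
  have h : DifferentiableOn ℂ (fun z : ℂ ↦ extend g (ρ * z)) (closedBall 0 1) := by
    refine DifferentiableOn.comp g.isHolo (by fun_prop) fun z hz ↦ ?_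
    have hz' : ‖z‖ ≤ 1 := by simpa using hz
    rw [mem_ball_zero_iff, norm_mul, Complex.norm_real, Real.norm_of_nonneg hρ.1.le]
    nlinarith [hρ.1, hρ.2]
  exact DifferentiableOn.mul (by fun_prop) (h.pow 2)

/-- Subordination moves every term to the unit circle, where the kernels are summed pointwise before
integrating. The bound does not depend on `s`, `ρ` or `r`, so all three limits can follow. -/
lemma sum_circleAverage_dilate_le {μ : ℝ} {φ : DiscAut} (hφ : IsCanonicalHyperbolic μ φ) (g : H2)
    (s : Finset ℤ) {ρ : ℝ} (hρ : ρ ∈ Set.Ioo (0 : ℝ) 1) {r : ℝ} (hr : r ∈ Set.Ico (0 : ℝ) 1) :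
    ∑ n ∈ s, Real.circleAverage (fun z ↦ ‖extend (fun z ↦ ((φ ^ n : DiscAut) z : ℂ)) z ^ 2 - 1‖ *
      ‖extend g (ρ * extend (fun z ↦ ((φ ^ n : DiscAut) z : ℂ)) z)‖ ^ 2) 0 r ≤
      8 * μ / (μ - 1) * ‖g‖ ^ 2 := by
  set h : ℂ → ℂ := fun z ↦ (z ^ 2 - 1) * extend g (ρ * z) ^ 2 with hh
  have hd : DiffContOnCl ℂ h (ball 0 1) := diffContOnCl_dilate g hρ
  have hC : 0 ≤ 8 * μ / (μ - 1) := div_nonneg (by linarith [hφ.1]) (by linarith [hφ.1])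
  have hc : ContinuousOn (fun z ↦ ‖h z‖) (sphere 0 |1|) := by
    rw [abs_one]
    exact (hd.continuousOn_ball.mono sphere_subset_closedBall).norm
  have hk : ∀ n ∈ s, CircleIntegrable
      (fun z ↦ (herglotzRieszKernel 0 ((φ ^ n : DiscAut) 0 : ℂ) z).re * ‖h z‖) 0 1 := fun n _ ↦ by
    refine ContinuousOn.circleIntegrable' (ContinuousOn.mul ?_ hc)
    exact Complex.continuous_re.comp_continuousOn (continuousOn_herglotzRieszKernel_sphere
      (by simpa using ((φ ^ n : DiscAut) 0).norm_lt_one))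
  have hg : Real.circleAverage (fun z ↦ ‖extend g (ρ * z)‖ ^ 2) 0 1 = sqMean g ρ := by
    rw [sqMean, Real.circleAverage_eq_circleAverage_zero_one (R := ρ)]
    simp
  have hgi : CircleIntegrable (fun z ↦ ‖extend g (ρ * z)‖ ^ 2) 0 1 := by
    have h1 : Continuous fun θ ↦ ‖extend g (ρ * circleMap 0 1 θ)‖ ^ 2 := by
      refine (Continuous.norm ?_).pow 2
      refine g.isHolo.continuousOn.comp_continuous (by fun_prop) fun θ ↦ ?_
      simpa [abs_of_pos hρ.1] using hρ.2
    exact h1.intervalIntegrable _ _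
  calc _ ≤ ∑ n ∈ s, Real.circleAverage
        (fun z ↦ (herglotzRieszKernel 0 ((φ ^ n : DiscAut) 0 : ℂ) z).re * ‖h z‖) 0 1 := by
        refine Finset.sum_le_sum fun n _ ↦ ?_
        have := circleAverage_norm_comp_le hd (φ ^ n).2.1 hr
        simpa only [hh, norm_mul, norm_pow] using this
    _ = Real.circleAverage (fun z ↦ ∑ n ∈ s,
        (herglotzRieszKernel 0 ((φ ^ n : DiscAut) 0 : ℂ) z).re * ‖h z‖) 0 1 :=
        (Real.circleAverage_fun_sum hk).symm
    _ ≤ Real.circleAverage (fun z ↦ (8 * μ / (μ - 1)) • ‖extend g (ρ * z)‖ ^ 2) 0 1 := by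
        refine Real.circleAverage_mono (CircleIntegrable.fun_sum s hk) hgi.const_smul
          fun z hz ↦ ?_
        have := sum_re_herglotzRieszKernel_mul_le hφ s (z := z) (by simpa using hz)
        simp only [hh, norm_mul, norm_pow, ← mul_assoc, ← Finset.sum_mul, smul_eq_mul]
        rw [Finset.sum_mul]
        gcongr
    _ = 8 * μ / (μ - 1) * sqMean g ρ := by
        rw [Real.circleAverage_fun_smul, hg, smul_eq_mul]
    _ ≤ _ := mul_le_mul_of_nonneg_left (g.sqMean_le ⟨hρ.1.le, hρ.2⟩) hC

lemma tendsto_circleAverage_dilate (g : H2) {φ : UnitDisc → UnitDisc} (hφ : IsHoloMap φ) {r : ℝ}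
    (hr : r ∈ Set.Ico (0 : ℝ) 1) :
    Tendsto (fun ρ : ℝ ↦ Real.circleAverage (fun z ↦ ‖extend (fun z ↦ (φ z : ℂ)) z ^ 2 - 1‖ *
      ‖extend g (ρ * extend (fun z ↦ (φ z : ℂ)) z)‖ ^ 2) 0 r) (𝓝[<] 1)
      (𝓝 (Real.circleAverage (fun z ↦ ‖extend (fun z ↦ (φ z : ℂ)) z ^ 2 - 1‖ *
        ‖extend g (extend (fun z ↦ (φ z : ℂ)) z)‖ ^ 2) 0 r)) := by
  set Φ : ℂ → ℂ := extend fun z ↦ (φ z : ℂ) with hΦ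
  have hsub : sphere (0 : ℂ) r ⊆ ball 0 1 := sphere_subset_ball hr.2
  have hΦc : ContinuousOn Φ (sphere 0 r) := hφ.continuousOn.mono hsub
  obtain ⟨z₀, hz₀, hmax⟩ := (isCompact_sphere (0 : ℂ) r).exists_isMaxOn
    ⟨r, by simpa using hr.1⟩ hΦc.norm
  have hz₁ : ‖Φ z₀‖ < 1 := by simpa using extend_mem_ball φ (hsub hz₀)
  obtain ⟨B, hB⟩ := (isCompact_closedBall (0 : ℂ) ‖Φ z₀‖).exists_bound_of_continuousOn
    (g.isHolo.continuousOn.mono (closedBall_subset_ball hz₁))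
  have hΦm : ∀ θ, ‖Φ (circleMap 0 r θ)‖ ≤ ‖Φ z₀‖ := fun θ ↦
    hmax (circleMap_mem_sphere 0 hr.1 θ)
  have hΦθ : Continuous fun θ ↦ Φ (circleMap 0 r θ) :=
    hΦc.comp_continuous (continuous_circleMap 0 r) (circleMap_mem_sphere 0 hr.1)
  have hmem : ∀ ρ ∈ Set.Ioo (0 : ℝ) 1, ∀ θ, ‖(ρ : ℂ) * Φ (circleMap 0 r θ)‖ ≤ ‖Φ z₀‖ := by
    intro ρ hρ θ
    rw [norm_mul, Complex.norm_real, Real.norm_of_nonneg hρ.1.le]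
    exact (mul_le_of_le_one_left (norm_nonneg _) hρ.2.le).trans (hΦm θ)
  have hev : ∀ᶠ ρ : ℝ in 𝓝[<] 1, ρ ∈ Set.Ioo (0 : ℝ) 1 := Ioo_mem_nhdsLT zero_lt_one
  simp only [Real.circleAverage_def]
  refine Tendsto.const_smul ?_ _
  -- The image of the circle lies in a compact disc on which `|g| ≤ B`, and `|Φ² - 1| ≤ 2`.
  refine intervalIntegral.tendsto_integral_filter_of_dominated_convergence (fun _ ↦ 2 * B ^ 2)
    ?_ ?_ (continuous_const.intervalIntegrable _ _) ?_
  · filter_upwards [hev] with ρ hρ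
    refine Continuous.aestronglyMeasurable (((hΦθ.pow 2).sub continuous_const).norm.mul ?_)
    refine (Continuous.norm ?_).pow 2
    refine g.isHolo.continuousOn.comp_continuous (continuous_const.mul hΦθ) fun θ ↦ ?_
    simpa using (hmem ρ hρ θ).trans_lt hz₁
  · filter_upwards [hev] with ρ hρ
    refine Eventually.of_forall fun θ _ ↦ ?_
    rw [norm_mul, norm_norm, norm_pow, norm_norm]
    refine mul_le_mul ?_ (pow_le_pow_left₀ (norm_nonneg _) (hB _ (by simpa using hmem ρ hρ θ)) 2)
      (by positivity) (by positivity)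
    refine (norm_sub_le _ _).trans ?_
    rw [norm_pow, norm_one]
    have := (hΦm θ).trans hz₁.le
    nlinarith [norm_nonneg (Φ (circleMap 0 r θ))]
  · refine Eventually.of_forall fun θ _ ↦ Tendsto.const_mul _ ((Tendsto.norm ?_).pow 2)
    have hc : ContinuousAt (extend g) (Φ (circleMap 0 r θ)) :=
      g.isHolo.continuousOn.continuousAt
        (isOpen_ball.mem_nhds (by simpa using (hΦm θ).trans_lt hz₁))
    refine hc.tendsto.comp (Tendsto.mono_left ?_ nhdsWithin_le_nhds)
    have : Continuous fun ρ : ℝ ↦ (ρ : ℂ) * Φ (circleMap 0 r θ) := by fun_prop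
    simpa using this.tendsto 1

theorem summable_norm_sq_compOp_zpow {μ : ℝ} {φ : DiscAut} (hφ : IsCanonicalHyperbolic μ φ)
    {f : H2} (hf : f ∈ sqrtH2) : Summable fun n : ℤ ↦ ‖compOp (φ ^ n) f‖ ^ 2 := by
  obtain ⟨t, -, ht, g, hg⟩ := hf
  refine summable_of_sum_le (c := 8 * μ / (μ - 1) * ‖g‖ ^ 2) (fun _ ↦ by positivity) fun s ↦ ?_
  refine H2.sum_norm_sq_le s _ fun r hr ↦ ?_
  have hlim := tendsto_finsetSum s fun n _ ↦
    tendsto_circleAverage_dilate g (φ := (φ ^ n : DiscAut)) (φ ^ n).2.1 hr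
  have h := le_of_tendsto hlim (b := 8 * μ / (μ - 1) * ‖g‖ ^ 2) (by
    filter_upwards [Ioo_mem_nhdsLT zero_lt_one] with ρ hρ
    exact sum_circleAverage_dilate_le hφ g s hρ hr)
  refine le_trans (le_of_eq (Finset.sum_congr rfl fun n _ ↦ ?_)) h
  refine Real.circleAverage_congr_sphere fun z hz ↦ ?_
  rw [abs_of_nonneg hr.1] at hz
  have hz1 := sphere_subset_ball hr.2 hz
  lift z to UnitDisc using by simpa using hz1
  simp only [extend_coe, compOp_apply]
  rw [hg, norm_mul, mul_pow, ← norm_pow, ht]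
  congr 2
  ring

end HardyDisc

end

end

theorem theorem3p2 (μ : ℝ) (φ : HardyDisc.DiscAut) (hφ : HardyDisc.IsCanonicalHyperbolic μ φ)
    (f : HardyDisc.H2) (hf0 : f ≠ 0) (hf : f ∈ HardyDisc.sqrtH2) :
    ∃ E : Set ℂ, MeasurableSet E ∧
      E ⊆ HardyDisc.pointSpectrum (HardyDisc.compOpRestrict φ f) ∩ Metric.sphere 0 1 ∧
      0 < HardyDisc.arcMeasure E := by
  have hzero : HardyDisc.compOp (φ ^ (0 : ℤ)) f = f := by
    ext z
    simp
  obtain ⟨E, hE, hpos, h⟩ := HardyDisc.exists_eigenvector_of_shift (HardyDisc.compOp φ)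
    (fun n : ℤ ↦ HardyDisc.compOp (φ ^ n) f)
    (fun n ↦ by
      ext z
      simp [zpow_add])
    (HardyDisc.summable_norm_sq_compOp_zpow hφ hf) (by rwa [hzero])
  refine ⟨E, hE, fun z hz ↦ ?_, hpos⟩
  obtain ⟨hz1, x, hx, hx0, hTx⟩ := h z hz
  refine ⟨?_, by simpa using hz1⟩
  -- The closed span of the shifted sequence is `D_f` by definition, so `x` is a vector of the
  -- restricted operator's domain.
  refine Module.End.hasEigenvalue_of_hasEigenvector (x := ⟨x, hx⟩) ?_
  rw [Module.End.hasEigenvector_iff, Module.End.mem_eigenspace_iff]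
  refine ⟨Subtype.ext hTx, fun h0 ↦ hx0 (congrArg Subtype.val h0)⟩
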